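/- Consider Bayesian games with players $N=\{1,\dots,n\}$, finite type sets $\Theta_i$, a common prior $\rho\in\Delta(\Theta)$ on $\Theta=\prod_i\Theta_i$ (possibly correlated), and finite nonempty action sets $A_i^{\theta_i}$ ($i\in N$, $\theta_i\in\Theta_i$), which are pairwise disjoint. Put $A_i=\bigcup_{\theta_i}A_i^{\theta_i}$, $A=\prod_iA_i$, $A^\theta=\prod_iA_i^{\theta_i}$, $E=\bigcup_iA_i$, $S_i=\prod_{\theta_i\in\Theta_i}A_i^{\theta_i}$ and $S=\prod_iS_i$; for $s\in S$ write $s(\theta)=(s_1(\theta_1),\dots,s_n(\theta_n))$. Player $i$ has utility $v_i:A\to\mathbb R_{\ge0}$, and the social welfare of $a\in A$ is $v_{\mathrm{SW}}(a)=f(\{a_1,\dots,a_n\})$ for a set function $f:2^E\to\mathbb R_{\ge0}$. The game is a *Bayesian valid utility game* if $f$ is monotone and submodular and, for all $a\in A$ and $i\in N$, $\sum_{j\in N}v_j(a)\le v_{\mathrm{SW}}(a)$ and $v_i(a)\ge f(\{a_j: j\in N\})-f(\{a_j:j\neq i\})$. A family $\pi\in\prod_{\theta\in\Theta}\Delta(A^\theta)$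 is a *strategic-form coarse Bayesian solution* (SFCBS) if for every $i\in N$ and $s_i\in S_i$ $$\mathbb E_{\theta\sim\rho}\,\mathbb E_{a\sim\pi(\theta)}[v_i(a)]\ \ge\ \mathbb E_{\theta\sim\rho}\,\mathbb E_{a\sim\pi(\theta)}[v_i(s_i(\theta_i),a_{-i})].$$ If $\mathrm{OPT}=\mathbb E_{\theta\sim\rho}[\max_{a\in A^\theta}v_{\mathrm{SW}}(a)]>0$, the *price of anarchy* for SFCBSs of the game is $$\mathrm{PoA}=\frac{\inf_{\pi\text{ SFCBS}}\mathbb E_{\theta\sim\rho}\,\mathbb E_{a\sim\pi(\theta)}[v_{\mathrm{SW}}(a)]}{\mathrm{OPT}}.$$ Then: 1. In every Bayesian valid utility game, every SFCBS $\pi$ satisfies $$\mathbb E_{\theta\sim\rho}\,\mathbb E_{a\sim\pi(\theta)}[v_{\mathrm{SW}}(a)]\ \ge\ \tfrac12\max_{s\in S}\mathbb E_{\theta\sim\rho}[v_{\mathrm{SW}}(s(\theta))].$$ 2. In every Bayesian valid utility game with $\mathrm{OPT}>0$ whose prior is a product distribution $\rho(\theta)=\prod_i\rho_i(\theta_i)$,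 $\ \mathrm{PoA}\ge\frac{1-1/\mathrm e}{2}$. 3. There is an absolute constant $c>0$ such that in every Bayesian valid utility game with $n\ge1$ players, arbitrary prior and $\mathrm{OPT}>0$, $\ \mathrm{PoA}\ge c/\sqrt n$. -/

import Mathlib

open scoped ENNReal

universe u v

/-- An `n`-player Bayesian game with type-dependent finite action sets and a social welfare
function given by a set function on the ground set of all actions.

`Act i t` is the set of actions available to player `i` when her type is `t`.  Forming the
disjoint unions `Σ t, Act i t` (all actions of player `i`) and `Σ i, Σ t, Act i t` (the ground set)
makes the action sets of different players and of different types disjoint. -/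
structure BayesianGame (n : ℕ) where
  /-- The finite set of types of each player. -/
  Typ : Fin n → Type u
  /-- The finite nonempty set of actions of each player at each of her types. -/
  Act : ∀ i, Typ i → Type v
  [fintypeTyp : ∀ i, Fintype (Typ i)]
  [fintypeAct : ∀ i t, Fintype (Act i t)]
  [nonemptyAct : ∀ i t, Nonempty (Act i t)]
  /-- The common prior, a probability distribution on type profiles. -/
  prior : (∀ i, Typ i) → ℝ
  prior_mem : prior ∈ stdSimplex ℝ (∀ i, Typ i)
  /-- The utility functions, defined on all action profiles. -/
  utility : Fin n → (∀ i, Σ t, Act i t) → ℝ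
  utility_nonneg : ∀ i a, 0 ≤ utility i a
  /-- The set function on the ground set that represents the social welfare. -/
  f : Finset (Σ i, Σ t, Act i t) → ℝ
  f_nonneg : ∀ X, 0 ≤ f X

namespace BayesianGame

attribute [instance] BayesianGame.fintypeTyp BayesianGame.fintypeAct BayesianGame.nonemptyAct

variable {n : ℕ} (G : BayesianGame.{u, v} n)

/-- All actions of player `i`, over all her types. -/
abbrev ActionOf (i : Fin n) : Type (max u v) := Σ t : G.Typ i, G.Act i t

/-- The ground set: all actions of all players. -/
abbrev Ground : Type (max u v) := Σ i : Fin n, G.ActionOf i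

/-- All action profiles. -/
abbrev Profile : Type (max u v) := ∀ i, G.ActionOf i

/-- Type profiles. -/
abbrev TypeProfile : Type u := ∀ i, G.Typ i

/-- Action profiles that are feasible at the type profile `θ`. -/
abbrev ProfileAt (θ : G.TypeProfile) : Type v := ∀ i, G.Act i (θ i)

/-- Strategies of player `i`: the choice of a feasible action for each of her types. -/
abbrev Strategy (i : Fin n) : Type (max u v) := ∀ t : G.Typ i, G.Act i t

/-- Strategy profiles. -/
abbrev StrategyProfile : Type (max u v) := ∀ i, G.Strategy i

/-- A profile feasible at `θ`, seen as an action profile. -/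
def toProfile {θ : G.TypeProfile} (a : G.ProfileAt θ) : G.Profile := fun i => ⟨θ i, a i⟩

/-- The profile of actions that a strategy profile plays at `θ`. -/
def play (s : G.StrategyProfile) (θ : G.TypeProfile) : G.ProfileAt θ := fun i => s i (θ i)

open Classical in
/-- Social welfare of an action profile: the value of `f` on the set of chosen actions. -/
noncomputable def welfare (a : G.Profile) : ℝ :=
  G.f (Finset.univ.image fun j => (⟨j, a j⟩ : G.Ground))

open Classical in
/-- Social welfare when player `i` selects nothing and the other players play as in `a`. -/
noncomputable def welfareWithout (i : Fin n) (a : G.Profile) : ℝ :=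
  G.f ((Finset.univ.filter fun j => j ≠ i).image fun j => (⟨j, a j⟩ : G.Ground))

open Classical in
/-- Bayesian valid utility games. -/
structure IsValidUtility : Prop where
  monotone : ∀ X Y : Finset G.Ground, X ⊆ Y → G.f X ≤ G.f Y
  submodular : ∀ (X Y : Finset G.Ground) (u : G.Ground), X ⊆ Y → u ∉ Y →
    G.f (insert u Y) - G.f Y ≤ G.f (insert u X) - G.f X
  total_utility : ∀ a : G.Profile, ∑ i, G.utility i a ≤ G.welfare a
  marginal_contribution : ∀ (a : G.Profile) (i : Fin n),
    G.welfare a - G.welfareWithout i a ≤ G.utility i a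

/-- The prior is a product distribution. -/
def IndependentPrior : Prop :=
  ∃ ρ : ∀ i, G.Typ i → ℝ, (∀ i, ρ i ∈ stdSimplex ℝ (G.Typ i)) ∧
    ∀ θ : G.TypeProfile, G.prior θ = ∏ i, ρ i (θ i)

/-- Type-dependent distributions: a probability distribution on the feasible action profiles
for each type profile. -/
def TypeDependentDist : Type (max u v) :=
  ∀ θ : G.TypeProfile, stdSimplex ℝ (G.ProfileAt θ)

/-- Expectation of `g θ a` for `θ` drawn from the prior and then `a` drawn from `π θ`. -/
noncomputable def expect (π : G.TypeDependentDist)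
    (g : ∀ θ : G.TypeProfile, G.ProfileAt θ → ℝ) : ℝ :=
  ∑ θ : G.TypeProfile, G.prior θ * ∑ a : G.ProfileAt θ, (π θ).1 a * g θ a

/-- Strategic-form coarse Bayesian solutions: no player gains in expectation by a unilateral
deviation to a single strategy, chosen independently of the recommendation. -/
def IsSFCBS (π : G.TypeDependentDist) : Prop :=
  ∀ (i : Fin n) (s : G.Strategy i),
    G.expect π (fun θ a => G.utility i (G.toProfile (Function.update a i (s (θ i))))) ≤
      G.expect π (fun _ a => G.utility i (G.toProfile a))

/-- Expected social welfare of a type-dependent distribution. -/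
noncomputable def expWelfare (π : G.TypeDependentDist) : ℝ :=
  G.expect π fun _ a => G.welfare (G.toProfile a)

/-- Largest expected social welfare of a strategy profile.  The supremum is over a finite nonempty
set, hence a maximum. -/
noncomputable def bestStrategyWelfare : ℝ :=
  ⨆ s : G.StrategyProfile,
    ∑ θ : G.TypeProfile, G.prior θ * G.welfare (G.toProfile (G.play s θ))

/-- Expected optimal social welfare, where the best feasible profile is taken at each type profile.
The supremum is over a finite nonempty set, hence a maximum. -/
noncomputable def optWelfare : ℝ :=
  ∑ θ : G.TypeProfile, G.prior θ * ⨆ a : G.ProfileAt θ, G.welfare (G.toProfile a)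

/-- Price of anarchy of a set `P` of type-dependent distributions, as a number in `[0, ∞]`:
the infimum of the expected welfare over `P`, divided by the expected optimal welfare
(which has to be positive for this to be meaningful). -/
noncomputable def priceOfAnarchy (P : Set G.TypeDependentDist) : ℝ≥0∞ :=
  (⨅ π ∈ P, ENNReal.ofReal (G.expWelfare π)) / ENNReal.ofReal G.optWelfare

end BayesianGame

/-!
The argument compares a solution with the best strategy profile, and the best strategy profile
with the optimum at each type profile.

*Smoothness.*  If player `i` deviates to `b i`, she receives at least the marginal value of `b i`
with respect to the chosen actions, and by submodularity these marginal values add up to at least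
the welfare of `b` minus that of `a`.  Taking expectations along a strategy profile, the equilibrium
inequalities and `∑ i, v_i ≤ v_SW` give the factor `1 / 2`
(`IsValidUtility.half_bestStrategyWelfare_le`).

*Representability by strategies.*  Let `b θ` be an optimal profile at `θ` and let every player draw
her action independently from the conditional law `q i t` of `b θ i` given `θ i = t`.  Such a draw
is a random strategy profile, so its expected welfare `B` is at most that of the best one
(`mixedWelfare_le_bestStrategyWelfare`), and it remains to compare `B` with the optimum.

For a product prior the sampled type-action pairs are independent across players and have the same
marginals as the optimum, so the correlation gap of monotone submodular functions gives
`B ≥ (1 - 1 / e) * OPT` (`IsMonoSubmodular.correlation_gap`).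

For a correlated prior fix `k`, let `X` be the independently drawn profile and let `R i` consist of
`k` further independent samples from the conditional law of player `i`.  The optimum is at most
`f X` plus the sum of the marginal values of `b θ i` over `X`, and each of these is at most the
marginal value of `R i` over `X` plus the marginal value of `b θ i` over `R i`.

* The marginal value of `R i` over `X` is at most `k` times that of a single fresh sample, and the
  latter add up to at most `B` in expectation (`IsMonoSubmodular.sum_resample_le`).
* Given the type of player `i`, her action in `b θ` and the members of `R i` are exchangeable, so the
  second term is at most a `1 / k` share of `f (R i)`, hence of `f X` plus the marginal value of
  `R i` over `X` (`IsMonoSubmodular.mul_increment_le`).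

Altogether `k * OPT ≤ (k ^ 2 + 2 * k + n) * B`, and `k` of order `√n` gives the bound.  The samples
`R i` are represented by iterates of the operator `insertAvg`.
-/

/-! ### Monotone submodular set functions -/

section SetFunctions

variable {E : Type*} [DecidableEq E]

/-- Monotone submodular set functions, with submodularity expressed by diminishing marginal
values.  The added element `u` may already belong to `Y`. -/
structure IsMonoSubmodular (f : Finset E → ℝ) : Prop where
  mono : ∀ ⦃X Y : Finset E⦄, X ⊆ Y → f X ≤ f Y
  diminishing : ∀ ⦃X Y : Finset E⦄ (u : E), X ⊆ Y →
    f (insert u Y) - f Y ≤ f (insert u X) - f X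

variable {f : Finset E → ℝ}

theorem IsMonoSubmodular.union_sub_le (hf : IsMonoSubmodular f) {ι : Type*} [DecidableEq ι]
    (e : ι → E) (T : Finset E) (s : Finset ι) :
    f (T ∪ s.image e) - f T ≤ ∑ i ∈ s, (f (insert (e i) T) - f T) := by
  induction s using Finset.induction_on with
  | empty => simp
  | insert i s hi ih =>
    rw [Finset.sum_insert hi, Finset.image_insert, Finset.union_insert]
    have := hf.diminishing (e i) (Finset.subset_union_left (s₁ := T) (s₂ := s.image e))
    linarith

/-- The marginal values of the members of a family with respect to the rest of the family add up
to at most the value of the whole family. -/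
theorem IsMonoSubmodular.sum_sub_erase_le (hf : IsMonoSubmodular f) {ι : Type*} [DecidableEq ι]
    (e : ι → E) (s : Finset ι) :
    ∑ i ∈ s, (f (s.image e) - f ((s.erase i).image e)) ≤ f (s.image e) - f ∅ := by
  suffices h : ∀ v ⊆ s,
      ∑ i ∈ v, (f (s.image e) - f ((s.erase i).image e)) ≤ f (v.image e) - f ∅ from
    h s subset_rfl
  intro v
  induction v using Finset.induction_on with
  | empty => simp
  | insert i v hi ih =>
    intro hv
    rw [Finset.sum_insert hi, Finset.image_insert]
    have his : i ∈ s := hv (Finset.mem_insert_self _ _)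
    have hvs : v ⊆ s.erase i := fun j hj =>
      Finset.mem_erase.2 ⟨fun h => hi (h ▸ hj), hv (Finset.mem_insert_of_mem hj)⟩
    have h1 := hf.diminishing (e i) (Finset.image_subset_image (f := e) hvs)
    rw [← Finset.image_insert, Finset.insert_erase his] at h1
    have h2 := ih fun j hj => hv (Finset.mem_insert_of_mem hj)
    linarith

end SetFunctions

/-! ### Adding random elements to a set -/

section RandomInsertion

variable {E α : Type*} [DecidableEq E] [Fintype α]

/-- The operator that replaces a set function by its expected value after insertion of `e a`, where
`a` is drawn with weights `q`. -/
def insertAvg (q : α → ℝ) (e : α → E) (g : Finset E → ℝ) (S : Finset E) : ℝ :=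
  ∑ a, q a * g (insert (e a) S)

variable {q : α → ℝ} {e : α → E} {f : Finset E → ℝ}

theorem insertAvg_mono (hq : ∀ a, 0 ≤ q a) {g h : Finset E → ℝ} (hgh : ∀ S, g S ≤ h S)
    (S : Finset E) : insertAvg q e g S ≤ insertAvg q e h S :=
  Finset.sum_le_sum fun a _ => mul_le_mul_of_nonneg_left (hgh _) (hq a)

theorem insertAvg_sub (g h : Finset E → ℝ) (S : Finset E) :
    insertAvg q e (fun S => g S - h S) S = insertAvg q e g S - insertAvg q e h S := by
  simp [insertAvg, mul_sub]

theorem isMonoSubmodular_insertAvg (hf : IsMonoSubmodular f) (hq : ∀ a, 0 ≤ q a) :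
    IsMonoSubmodular (insertAvg q e f) where
  mono _ _ h := Finset.sum_le_sum fun a _ =>
    mul_le_mul_of_nonneg_left (hf.mono (Finset.insert_subset_insert _ h)) (hq a)
  diminishing X Y u h := by
    simp only [insertAvg, ← Finset.sum_sub_distrib, ← mul_sub]
    refine Finset.sum_le_sum fun a _ => mul_le_mul_of_nonneg_left ?_ (hq a)
    rw [Finset.insert_comm _ u, Finset.insert_comm _ u]
    exact hf.diminishing u (Finset.insert_subset_insert _ h)

theorem insertAvg_sub_self (hq1 : ∑ a, q a = 1) (S : Finset E) :
    insertAvg q e f S - f S = ∑ a, q a * (f (insert (e a) S) - f S) := by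
  simp [insertAvg, mul_sub, ← Finset.sum_mul, hq1]

theorem IsMonoSubmodular.iterate_insertAvg (hf : IsMonoSubmodular f) (hq : ∀ a, 0 ≤ q a) (k : ℕ) :
    IsMonoSubmodular ((insertAvg q e)^[k] f) := by
  induction k with
  | zero => exact hf
  | succ k ih => rw [Function.iterate_succ_apply']; exact isMonoSubmodular_insertAvg ih hq

theorem IsMonoSubmodular.le_insertAvg (hf : IsMonoSubmodular f) (hq : ∀ a, 0 ≤ q a)
    (hq1 : ∑ a, q a = 1) (S : Finset E) : f S ≤ insertAvg q e f S := by
  rw [← sub_nonneg, insertAvg_sub_self hq1]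
  exact Finset.sum_nonneg fun a _ =>
    mul_nonneg (hq a) (sub_nonneg.2 (hf.mono (Finset.subset_insert _ _)))

theorem IsMonoSubmodular.le_iterate_insertAvg (hf : IsMonoSubmodular f) (hq : ∀ a, 0 ≤ q a)
    (hq1 : ∑ a, q a = 1) (k : ℕ) (S : Finset E) : f S ≤ (insertAvg q e)^[k] f S := by
  induction k with
  | zero => exact le_rfl
  | succ k ih =>
    rw [Function.iterate_succ_apply']
    exact ih.trans ((hf.iterate_insertAvg hq k).le_insertAvg hq hq1 S)

/-- Independent samples have diminishing expected marginal values. -/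
theorem IsMonoSubmodular.iterate_insertAvg_increment_antitone (hf : IsMonoSubmodular f)
    (hq : ∀ a, 0 ≤ q a) (hq1 : ∑ a, q a = 1) (S : Finset E) :
    Antitone fun j : ℕ =>
      (insertAvg q e)^[j + 1] f S - (insertAvg q e)^[j] f S := by
  refine antitone_nat_of_succ_le fun j => ?_
  induction j generalizing S with
  | zero =>
    simp only [zero_add, Function.iterate_succ_apply', Function.iterate_zero_apply]
    rw [← insertAvg_sub (e := e), insertAvg_sub_self hq1]
    calc insertAvg q e (fun S => insertAvg q e f S - f S) S
        ≤ insertAvg q e (fun _ => ∑ a, q a * (f (insert (e a) S) - f S)) S := by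
          refine Finset.sum_le_sum fun b _ => mul_le_mul_of_nonneg_left ?_ (hq b)
          beta_reduce
          rw [insertAvg_sub_self hq1]
          exact Finset.sum_le_sum fun a _ => mul_le_mul_of_nonneg_left
            (hf.diminishing _ (Finset.subset_insert _ _)) (hq a)
      _ = _ := by simp [insertAvg, ← Finset.sum_mul, hq1]
  | succ j ih =>
    have h := insertAvg_mono (e := e) hq ih S
    rw [insertAvg_sub, insertAvg_sub] at h
    simpa only [Function.iterate_succ_apply'] using h

theorem IsMonoSubmodular.iterate_insertAvg_sub_le (hf : IsMonoSubmodular f)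
    (hq : ∀ a, 0 ≤ q a) (hq1 : ∑ a, q a = 1) (k : ℕ) (S : Finset E) :
    (insertAvg q e)^[k] f S - f S ≤ k * (insertAvg q e f S - f S) := by
  have h := Finset.sum_range_sub (fun j => (insertAvg q e)^[j] f S) k
  simp only [Function.iterate_zero_apply] at h
  rw [← h]
  refine (Finset.sum_le_card_nsmul _ _ _ fun j _ =>
    hf.iterate_insertAvg_increment_antitone hq hq1 S (Nat.zero_le j)).trans ?_
  simp

/-- By exchangeability, the expected marginal value of one more sample after `k` independent
samples is at most a `1 / k` share of their joint value. -/
theorem IsMonoSubmodular.mul_increment_le (hf : IsMonoSubmodular f)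
    (hq : ∀ a, 0 ≤ q a) (hq1 : ∑ a, q a = 1) (k : ℕ) (S : Finset E) :
    k * ((insertAvg q e)^[k + 1] f S - (insertAvg q e)^[k] f S) ≤
      (insertAvg q e)^[k] f S - f S := by
  have h := Finset.sum_range_sub (fun j => (insertAvg q e)^[j] f S) k
  simp only [Function.iterate_zero_apply] at h
  rw [← h]
  refine le_trans ?_ (Finset.card_nsmul_le_sum _ _ _ fun j hj =>
    hf.iterate_insertAvg_increment_antitone hq hq1 S (Finset.mem_range.1 hj).le)
  simp

/-- The marginal value of `b` over `S` is at most that of `k` random elements over `S`, hence at most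
`k` times that of one random element, plus the marginal value of `b` over the `k` random
elements. -/
theorem IsMonoSubmodular.marginal_le (hf : IsMonoSubmodular f) (hq : ∀ a, 0 ≤ q a)
    (hq1 : ∑ a, q a = 1)
    (k : ℕ) (b : E) (S : Finset E) :
    f (insert b S) - f S ≤ k * ∑ a, q a * (f (insert (e a) S) - f S) +
      ((insertAvg q e)^[k] f {b} - (insertAvg q e)^[k] f ∅) := by
  have h1 := hf.le_iterate_insertAvg hq hq1 (e := e) k (insert b S)
  have h2 := (hf.iterate_insertAvg hq (e := e) k).diminishing b (Finset.empty_subset S)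
  have h3 := hf.iterate_insertAvg_sub_le hq hq1 (e := e) k S
  rw [insertAvg_sub_self hq1] at h3
  rw [insert_empty_eq] at h2
  linarith

/-- The average of the last term of `IsMonoSubmodular.marginal_le` when `b` is itself drawn with
weights `q`. -/
theorem IsMonoSubmodular.mul_sum_marginal_le (hf : IsMonoSubmodular f) (hf0 : 0 ≤ f ∅)
    (hq : ∀ a, 0 ≤ q a)
    (hq1 : ∑ a, q a = 1) (k : ℕ) (S : Finset E) :
    k * ∑ a, q a * ((insertAvg q e)^[k] f {e a} - (insertAvg q e)^[k] f ∅) ≤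
      f S + k * ∑ a, q a * (f (insert (e a) S) - f S) := by
  have h1 := hf.mul_increment_le hq hq1 (e := e) k ∅
  have h2 := (hf.iterate_insertAvg hq (e := e) k).mono (Finset.empty_subset S)
  have h3 := hf.iterate_insertAvg_sub_le hq hq1 (e := e) k S
  rw [insertAvg_sub_self hq1] at h3
  rw [Function.iterate_succ_apply', insertAvg_sub_self hq1] at h1
  simp only [insert_empty_eq] at h1
  linarith

end RandomInsertion

/-! ### Product weights on finite products -/

section ProductWeights

variable {ι : Type*} [Fintype ι] [DecidableEq ι] {α β : ι → Type*}
  [∀ i, Fintype (α i)] [∀ i, Fintype (β i)]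

/-- Push-forward of product weights under a map that acts coordinatewise. -/
theorem sum_prod_mul_comp [∀ i, DecidableEq (β i)] (w : ∀ i, α i → ℝ) (g : ∀ i, α i → β i)
    (w' : ∀ i, β i → ℝ) (hw' : ∀ i b, ∑ a, (if g i a = b then w i a else 0) = w' i b)
    (h : (∀ i, β i) → ℝ) :
    ∑ x : ∀ i, α i, (∏ i, w i (x i)) * h (fun i => g i (x i)) =
      ∑ y : ∀ i, β i, (∏ i, w' i (y i)) * h y := by
  simp only [← hw', Finset.prod_univ_sum, Fintype.piFinset_univ, Finset.sum_mul]
  rw [Finset.sum_comm]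
  refine Finset.sum_congr rfl fun x _ => ?_
  rw [Finset.sum_eq_single fun i => g i (x i)]
  · simp
  · intro y _ hy
    obtain ⟨i, hi⟩ := Function.ne_iff.1 hy
    rw [Finset.prod_eq_zero (Finset.mem_univ i) (if_neg hi.symm), zero_mul]
  · simp

theorem sum_prod_eq_one {w : ∀ i, α i → ℝ} (hw : ∀ i, ∑ a, w i a = 1) :
    ∑ x : ∀ i, α i, ∏ i, w i (x i) = 1 := by
  have := Finset.prod_univ_sum (fun i => (Finset.univ : Finset (α i))) w
  simp only [hw, Finset.prod_const_one, Fintype.piFinset_univ] at this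
  exact this.symm

/-- Exchanging coordinate `i` with an independent sample. -/
theorem sum_prod_mul_update {w : ∀ i, α i → ℝ} (hw : ∀ i, ∑ a, w i a = 1) (i : ι)
    (v : α i → ℝ) (h : (∀ i, α i) → ℝ) :
    ∑ x : ∀ i, α i, (∏ j, w j (x j)) * ∑ a, v a * h (Function.update x i a) =
      ∑ x : ∀ i, α i, ((∏ j ∈ Finset.univ.erase i, w j (x j)) * v (x i)) * h x := by
  have hprod : ∀ x : ∀ i, α i,
      ∏ j, w j (x j) = w i (x i) * ∏ j ∈ Finset.univ.erase i, w j (x j) := fun x =>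
    (Finset.mul_prod_erase _ _ (Finset.mem_univ i)).symm
  have hupd : ∀ (x : ∀ i, α i) (a : α i),
      ∏ j ∈ Finset.univ.erase i, w j (Function.update x i a j) =
        ∏ j ∈ Finset.univ.erase i, w j (x j) := fun x a =>
    Finset.prod_congr rfl fun j hj => by
      rw [Function.update_of_ne (Finset.ne_of_mem_erase hj)]
  have hinv : Function.Involutive
      (fun p : (∀ i, α i) × α i => (Function.update p.1 i p.2, p.1 i)) := by
    rintro ⟨x, a⟩; simp
  calc _ = ∑ p : (∀ i, α i) × α i,
        w i (p.1 i) * (∏ j ∈ Finset.univ.erase i, w j (p.1 j)) *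
          (v p.2 * h (Function.update p.1 i p.2)) := by
        simp only [hprod, Finset.mul_sum, Fintype.sum_prod_type]
    _ = ∑ p : (∀ i, α i) × α i,
        w i p.2 * (((∏ j ∈ Finset.univ.erase i, w j (p.1 j)) * v (p.1 i)) * h p.1) := by
        rw [← Equiv.sum_comp hinv.toPerm]
        refine Finset.sum_congr rfl fun p _ => ?_
        simp only [Function.Involutive.coe_toPerm, hupd, Function.update_self,
          Function.update_idem, Function.update_eq_self]
        ring
    _ = _ := by simp only [Fintype.sum_prod_type, ← Finset.sum_mul, hw, one_mul]

/-- Coordinate `i` of a sample from a product distribution is distributed according to `w i`. -/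
theorem sum_prod_mul_eval {w : ∀ i, α i → ℝ} (hw : ∀ i, ∑ a, w i a = 1) (i : ι)
    (φ : α i → ℝ) :
    ∑ x : ∀ i, α i, (∏ j, w j (x j)) * φ (x i) = ∑ a, w i a * φ a := by
  have h := sum_prod_mul_update hw i (w i) fun x => φ (x i)
  simp only [Function.update_self, ← Finset.sum_mul, sum_prod_eq_one hw, one_mul] at h
  rw [h]
  refine Finset.sum_congr rfl fun x _ => ?_
  rw [Finset.prod_erase_mul _ _ (Finset.mem_univ i)]

end ProductWeights

/-! ### Images of partial choices -/

section PartialImage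

variable {ι E : Type*} [Fintype ι] [DecidableEq E] {α : ι → Type*}

/-- The set of those `e i a` for which coordinate `i` of `x` is `some a`. -/
def partialImage (e : ∀ i, α i → E) (x : ∀ i, Option (α i)) : Finset E :=
  Finset.univ.biUnion fun i => ((x i).map (e i)).toFinset

theorem partialImage_some (e : ∀ i, α i → E) (x : ∀ i, α i) :
    partialImage e (fun i => some (x i)) = Finset.univ.image fun i => e i (x i) := by
  ext b; simp [partialImage, eq_comm]

variable [DecidableEq ι]

theorem partialImage_update_some (e : ∀ i, α i → E) (x : ∀ i, Option (α i)) (i : ι) (a : α i) :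
    partialImage e (Function.update x i (some a)) =
      insert (e i a) (partialImage e (Function.update x i none)) := by
  ext b
  simp only [partialImage, Finset.mem_biUnion, Finset.mem_univ, true_and, Finset.mem_insert]
  constructor
  · rintro ⟨j, hj⟩
    by_cases h : j = i
    · subst h; left; simpa [eq_comm] using hj
    · right; exact ⟨j, by simpa [Function.update_of_ne h] using hj⟩
  · rintro (rfl | ⟨j, hj⟩)
    · exact ⟨i, by simp⟩
    · by_cases h : j = i
      · subst h; simp at hj
      · exact ⟨j, by simpa [Function.update_of_ne h] using hj⟩

theorem partialImage_update_none_subset (e : ∀ i, α i → E) (x : ∀ i, Option (α i)) (i : ι) :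
    partialImage e (Function.update x i none) ⊆ partialImage e x := by
  intro b
  simp only [partialImage, Finset.mem_biUnion, Finset.mem_univ, true_and]
  rintro ⟨j, hj⟩
  by_cases h : j = i
  · subst h; simp at hj
  · exact ⟨j, by simpa [Function.update_of_ne h] using hj⟩

end PartialImage

/-! ### Independent sampling and the correlation gap -/

section CorrelationGap

variable {ι E : Type*} [Fintype ι] [DecidableEq ι] [DecidableEq E] {α : ι → Type*}
  [∀ i, Fintype (α i)] {f : Finset E → ℝ} {w : ∀ i, α i → ℝ}

/-- If `X` has independent coordinates, the expected marginal values, with respect to `X`, of an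
independent copy of each coordinate add up to at most the expected value of `X`. -/
theorem IsMonoSubmodular.sum_resample_le (hf : IsMonoSubmodular f) (hf0 : 0 ≤ f ∅)
    (hw0 : ∀ i a, 0 ≤ w i a) (hw : ∀ i, ∑ a, w i a = 1) (e : ∀ i, α i → E) :
    ∑ x : ∀ i, α i, (∏ j, w j (x j)) *
        ∑ i, ∑ a, w i a * (f (insert (e i a) (Finset.univ.image fun j => e j (x j))) -
          f (Finset.univ.image fun j => e j (x j))) ≤
      ∑ x : ∀ i, α i, (∏ j, w j (x j)) * f (Finset.univ.image fun j => e j (x j)) := by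
  set ψ : ι → (∀ i, α i) → ℝ := fun i x => f (Finset.univ.image fun j => e j (x j)) -
    f ((Finset.univ.erase i).image fun j => e j (x j)) with hψ
  have hψu : ∀ i x a, f (insert (e i a) (Finset.univ.image fun j => e j (x j))) -
      f (Finset.univ.image fun j => e j (x j)) ≤ ψ i (Function.update x i a) := by
    intro i x a
    have h1 : (Finset.univ.erase i).image (fun j => e j (Function.update x i a j)) =
        (Finset.univ.erase i).image fun j => e j (x j) :=
      Finset.image_congr fun j hj => by
        simp only [Function.update_of_ne (Finset.ne_of_mem_erase hj)]
    have h2 : Finset.univ.image (fun j => e j (Function.update x i a j)) =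
        insert (e i a) ((Finset.univ.erase i).image fun j => e j (x j)) := by
      rw [← h1, ← Finset.insert_erase (Finset.mem_univ i), Finset.image_insert]
      simp
    simp only [hψ, h1, h2]
    exact hf.diminishing _ (Finset.image_subset_image (Finset.erase_subset _ _))
  have hres : ∀ i, ∑ x : ∀ i, α i, (∏ j, w j (x j)) * ∑ a, w i a * ψ i (Function.update x i a) =
      ∑ x : ∀ i, α i, (∏ j, w j (x j)) * ψ i x := by
    intro i
    rw [sum_prod_mul_update hw]
    refine Finset.sum_congr rfl fun x _ => ?_
    rw [Finset.prod_erase_mul _ _ (Finset.mem_univ i)]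
  calc _ ≤ ∑ x : ∀ i, α i, (∏ j, w j (x j)) *
        ∑ i, ∑ a, w i a * ψ i (Function.update x i a) := by
        refine Finset.sum_le_sum fun x _ => mul_le_mul_of_nonneg_left ?_
          (Finset.prod_nonneg fun j _ => hw0 _ _)
        exact Finset.sum_le_sum fun i _ => Finset.sum_le_sum fun a _ =>
          mul_le_mul_of_nonneg_left (hψu i x a) (hw0 _ _)
    _ = ∑ x : ∀ i, α i, (∏ j, w j (x j)) * ∑ i, ψ i x := by
        simp only [Finset.mul_sum (Finset.univ : Finset ι)]
        rw [Finset.sum_comm, Finset.sum_congr rfl fun i _ => hres i, Finset.sum_comm]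
    _ ≤ _ := by
        refine Finset.sum_le_sum fun x _ => mul_le_mul_of_nonneg_left ?_
          (Finset.prod_nonneg fun j _ => hw0 _ _)
        have := hf.sum_sub_erase_le (fun j => e j (x j)) Finset.univ
        simp only [hψ]
        linarith

/-- The weights of a choice that is `none` with probability `1 - t` and otherwise drawn with
weights `p`. -/
def thinned {β : Type*} (p : β → ℝ) (t : ℝ) : Option β → ℝ
  | none => 1 - t
  | some a => t * p a

/-- The derivative of `thinned p t` in `t`. -/
def thinnedDeriv {β : Type*} (p : β → ℝ) : Option β → ℝ
  | none => -1
  | some a => p a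

theorem hasDerivAt_thinned {β : Type*} (p : β → ℝ) (t : ℝ) (b : Option β) :
    HasDerivAt (fun t => thinned p t b) (thinnedDeriv p b) t := by
  cases b with
  | none => simpa [thinned, thinnedDeriv] using (hasDerivAt_id t).const_sub 1
  | some a => simpa [thinned, thinnedDeriv] using (hasDerivAt_id t).mul_const (p a)

theorem sum_thinned {β : Type*} [Fintype β] {p : β → ℝ} (hp : ∑ a, p a = 1) (t : ℝ) :
    ∑ b, thinned p t b = 1 := by
  simp [Fintype.sum_option, thinned, ← Finset.mul_sum, hp]

theorem thinned_nonneg {β : Type*} {p : β → ℝ} (hp : ∀ a, 0 ≤ p a) {t : ℝ} (ht0 : 0 ≤ t)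
    (ht1 : t ≤ 1) (b : Option β) : 0 ≤ thinned p t b := by
  cases b with
  | none => exact sub_nonneg.2 ht1
  | some a => exact mul_nonneg ht0 (hp a)

/-- The expected value of `f` on the set obtained by keeping each coordinate of a sample from a
product distribution independently with probability `t`. -/
def thinnedValue (f : Finset E → ℝ) (w : ∀ i, α i → ℝ) (e : ∀ i, α i → E) (t : ℝ) : ℝ :=
  ∑ x : ∀ i, Option (α i), (∏ i, thinned (w i) t (x i)) * f (partialImage e x)

theorem hasDerivAt_thinnedValue (hw : ∀ i, ∑ a, w i a = 1) (e : ∀ i, α i → E) (t : ℝ) :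
    HasDerivAt (thinnedValue f w e)
      (∑ x : ∀ i, Option (α i), (∏ i, thinned (w i) t (x i)) * ∑ i, ∑ a, w i a *
        (f (partialImage e (Function.update x i (some a))) -
          f (partialImage e (Function.update x i none)))) t := by
  have h : HasDerivAt (thinnedValue f w e)
      (∑ x : ∀ i, Option (α i), (∑ i, (∏ j ∈ Finset.univ.erase i, thinned (w j) t (x j)) •
        thinnedDeriv (w i) (x i)) * f (partialImage e x)) t :=
    HasDerivAt.fun_sum fun x _ => HasDerivAt.mul_const
      (HasDerivAt.fun_finsetProd fun i _ => hasDerivAt_thinned (w i) t (x i)) _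
  convert h using 1
  simp only [smul_eq_mul, Finset.sum_mul, Finset.mul_sum (Finset.univ : Finset ι)]
  rw [Finset.sum_comm, Finset.sum_comm (t := (Finset.univ : Finset ι))]
  refine Finset.sum_congr rfl fun i _ => ?_
  rw [← sum_prod_mul_update (fun i => sum_thinned (hw i) t) i (thinnedDeriv (w i))
    fun x => f (partialImage e x)]
  refine Finset.sum_congr rfl fun x _ => ?_
  simp only [Fintype.sum_option, thinnedDeriv, mul_sub, Finset.sum_sub_distrib, ← Finset.sum_mul,
    hw]
  ring

/-- **Correlation gap**, for one random choice per coordinate.  The hypothesis on `M` is the only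
property of a correlated choice that is needed: `M` exceeds the value of a set by at most the
expected marginal values of all coordinates.  The value `F t` of the sample thinned to density `t`
satisfies `F' ≥ M - F`, so `exp t * (F t - M)` increases. -/
theorem IsMonoSubmodular.correlation_gap (hf : IsMonoSubmodular f) (hf0 : ∀ S, 0 ≤ f S)
    (hw0 : ∀ i a, 0 ≤ w i a) (hw : ∀ i, ∑ a, w i a = 1) (e : ∀ i, α i → E) {M : ℝ}
    (hM : ∀ S, M ≤ f S + ∑ i, ∑ a, w i a * (f (insert (e i a) S) - f S)) :
    (1 - 1 / Real.exp 1) * M ≤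
      ∑ x : ∀ i, α i, (∏ i, w i (x i)) * f (Finset.univ.image fun i => e i (x i)) := by
  classical
  set F := thinnedValue f w e with hF
  have hpos : ∀ {t : ℝ}, 0 ≤ t → t ≤ 1 → ∀ x : ∀ i, Option (α i),
      0 ≤ ∏ i, thinned (w i) t (x i) := fun h0 h1 x =>
    Finset.prod_nonneg fun i _ => thinned_nonneg (hw0 i) h0 h1 _
  have hone : F 1 = ∑ x : ∀ i, α i, (∏ i, w i (x i)) *
      f (Finset.univ.image fun i => e i (x i)) := by
    simp only [← partialImage_some]
    refine (sum_prod_mul_comp w (fun i => some) (fun i => thinned (w i) 1) ?_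
      fun x => f (partialImage e x)).symm
    rintro i (_ | a) <;> simp [thinned]
  have hzero : 0 ≤ F 0 := Finset.sum_nonneg fun x _ =>
    mul_nonneg (hpos le_rfl zero_le_one x) (hf0 _)
  have hderiv : ∀ t ∈ Set.Ioo (0 : ℝ) 1, M - F t ≤ deriv F t := by
    intro t ht
    rw [(hasDerivAt_thinnedValue hw e t).deriv]
    have hMF : M - F t = ∑ x : ∀ i, Option (α i), (∏ i, thinned (w i) t (x i)) *
        (M - f (partialImage e x)) := by
      simp only [mul_sub, Finset.sum_sub_distrib, ← Finset.sum_mul,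
        sum_prod_eq_one fun i => sum_thinned (hw i) t, one_mul, hF, thinnedValue]
    rw [hMF]
    refine Finset.sum_le_sum fun x _ => mul_le_mul_of_nonneg_left ?_ (hpos ht.1.le ht.2.le x)
    refine (sub_le_iff_le_add'.2 (hM _)).trans ?_
    refine Finset.sum_le_sum fun i _ => Finset.sum_le_sum fun a _ =>
      mul_le_mul_of_nonneg_left ?_ (hw0 i a)
    rw [partialImage_update_some]
    exact hf.diminishing _ (partialImage_update_none_subset e x i)
  have hdG : ∀ t : ℝ, HasDerivAt (fun t => Real.exp t * (F t - M))
      (Real.exp t * (F t - M) + Real.exp t * deriv F t) t := fun t =>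
    (Real.hasDerivAt_exp t).mul
      ((hasDerivAt_thinnedValue hw e t).differentiableAt.hasDerivAt.sub_const M)
  have hmono : MonotoneOn (fun t => Real.exp t * (F t - M)) (Set.Icc 0 1) := by
    refine monotoneOn_of_deriv_nonneg (convex_Icc 0 1)
      (fun t _ => (hdG t).continuousAt.continuousWithinAt)
      (fun t _ => (hdG t).differentiableAt.differentiableWithinAt) fun t ht => ?_
    rw [interior_Icc] at ht
    rw [(hdG t).deriv, ← mul_add]
    exact mul_nonneg (Real.exp_pos t).le (by linarith [hderiv t ht])
  have h := hmono (Set.left_mem_Icc.2 zero_le_one) (Set.right_mem_Icc.2 zero_le_one) zero_le_one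
  simp only [Real.exp_zero, one_mul] at h
  rw [← hone]
  have he := Real.exp_pos 1
  have : F 1 - M ≥ -M / Real.exp 1 := by
    rw [ge_iff_le, div_le_iff₀ he]; linarith
  have h2 : (1 - 1 / Real.exp 1) * M = M + -M / Real.exp 1 := by ring
  linarith

end CorrelationGap

/-! ### Conditional distributions -/

section Conditional

theorem sum_mul_comp_eq_sum_fiber {Ω β : Type*} [Fintype Ω] [Fintype β] [DecidableEq β]
    (ρ : Ω → ℝ) (h : Ω → β) (g : β → ℝ) :
    ∑ ω, ρ ω * g (h ω) = ∑ b, (∑ ω, if h ω = b then ρ ω else 0) * g b := by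
  simp only [Finset.sum_mul, ite_mul, zero_mul]
  rw [Finset.sum_comm]
  simp

/-- The conditional distribution `q t` of `a` given that `τ` takes the value `t`.  It is an
arbitrary point mass if the value `t` has probability zero. -/
theorem exists_conditional {Ω T : Type*} [Fintype Ω] [Fintype T] {A : T → Type*}
    [∀ t, Fintype (A t)] [∀ t, Nonempty (A t)] {ρ : Ω → ℝ} (hρ : ∀ ω, 0 ≤ ρ ω)
    (τ : Ω → T) (a : ∀ ω, A (τ ω)) :
    ∃ q : ∀ t, A t → ℝ, (∀ t b, 0 ≤ q t b) ∧ (∀ t, ∑ b, q t b = 1) ∧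
      ∀ φ : ∀ t, A t → ℝ,
        ∑ ω, ρ ω * φ (τ ω) (a ω) = ∑ ω, ρ ω * ∑ b, q (τ ω) b * φ (τ ω) b := by
  classical
  set m : (Σ t, A t) → ℝ := fun y => ∑ ω, if (⟨τ ω, a ω⟩ : Σ t, A t) = y then ρ ω else 0 with hm
  set P : T → ℝ := fun t => ∑ ω, if τ ω = t then ρ ω else 0 with hP
  have hm0 : ∀ y, 0 ≤ m y := fun y =>
    Finset.sum_nonneg fun ω _ => by split_ifs <;> simp [hρ]
  have hmP : ∀ t, ∑ b, m ⟨t, b⟩ = P t := by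
    intro t
    simp only [hm, hP]
    rw [Finset.sum_comm]
    refine Finset.sum_congr rfl fun ω _ => ?_
    by_cases h : τ ω = t
    · subst h; simp
    · simp [h]
  have hP0 : ∀ t, 0 ≤ P t := fun t => hmP t ▸ Finset.sum_nonneg fun b _ => hm0 _
  have hPq : ∀ t b, P t = 0 → m ⟨t, b⟩ = 0 := fun t b h =>
    (Finset.sum_eq_zero_iff_of_nonneg fun b _ => hm0 ⟨t, b⟩).1 ((hmP t).trans h) b
      (Finset.mem_univ b)
  let q : ∀ t, A t → ℝ := fun t b =>
    if P t = 0 then (if b = Classical.arbitrary _ then 1 else 0) else m ⟨t, b⟩ / P t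
  refine ⟨q, fun t b => ?_, fun t => ?_, fun φ => ?_⟩
  · simp only [q]
    split_ifs
    exacts [zero_le_one, le_rfl, div_nonneg (hm0 _) (hP0 _)]
  · by_cases h : P t = 0
    · simp [q, h]
    · simp only [q, h, if_false]
      rw [← Finset.sum_div, hmP, div_self h]
  · refine (sum_mul_comp_eq_sum_fiber ρ (fun ω => (⟨τ ω, a ω⟩ : Σ t, A t))
      fun y => φ y.1 y.2).trans (Eq.trans ?_
      (sum_mul_comp_eq_sum_fiber ρ τ fun t => ∑ b, q t b * φ t b).symm)
    rw [Fintype.sum_sigma]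
    refine Finset.sum_congr rfl fun t _ => ?_
    rw [Finset.mul_sum]
    refine Finset.sum_congr rfl fun b _ => ?_
    change m ⟨t, b⟩ * φ t b = P t * (q t b * φ t b)
    by_cases h : P t = 0
    · rw [hPq t b h, h]; simp
    · simp only [q, if_neg h]; field_simp

end Conditional

namespace BayesianGame

variable {n : ℕ} (G : BayesianGame.{u, v} n)

/-! ### Smoothness of valid utility games -/

open Classical in
theorem IsValidUtility.isMonoSubmodular {G : BayesianGame.{u, v} n} (hG : G.IsValidUtility) :
    IsMonoSubmodular G.f where
  mono := hG.monotone
  diminishing X Y w h := by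
    by_cases hw : w ∈ Y
    · have := hG.monotone X (insert w X) (Finset.subset_insert _ _)
      rw [Finset.insert_eq_of_mem hw]
      linarith
    · exact hG.submodular X Y w h hw

open Classical in
/-- The set of actions chosen in a profile that is feasible at `θ`. -/
noncomputable def chosen {θ : G.TypeProfile} (a : G.ProfileAt θ) : Finset G.Ground :=
  Finset.univ.image fun j => (⟨j, θ j, a j⟩ : G.Ground)

theorem welfare_toProfile {θ : G.TypeProfile} (a : G.ProfileAt θ) :
    G.welfare (G.toProfile a) = G.f (G.chosen a) := rfl

open Classical in
theorem IsValidUtility.welfare_le_add_sum {G : BayesianGame.{u, v} n} (hG : G.IsValidUtility)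
    {θ : G.TypeProfile} (b : G.ProfileAt θ) (S : Finset G.Ground) :
    G.welfare (G.toProfile b) ≤ G.f S + ∑ i, (G.f (insert ⟨i, θ i, b i⟩ S) - G.f S) := by
  have h := hG.isMonoSubmodular.union_sub_le (fun i => (⟨i, θ i, b i⟩ : G.Ground)) S Finset.univ
  have h2 : G.f (G.chosen b) ≤
      G.f (S ∪ Finset.univ.image fun i => (⟨i, θ i, b i⟩ : G.Ground)) :=
    hG.isMonoSubmodular.mono Finset.subset_union_right
  rw [welfare_toProfile]
  linarith

open Classical in
/-- A deviating player gets at least the marginal value of the new action with respect to all the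
actions of the original profile. -/
theorem IsValidUtility.marginal_le_utility {G : BayesianGame.{u, v} n} (hG : G.IsValidUtility)
    {θ : G.TypeProfile} (a : G.ProfileAt θ) (i : Fin n) (b : G.Act i (θ i)) :
    G.f (insert ⟨i, θ i, b⟩ (G.chosen a)) - G.f (G.chosen a) ≤
      G.utility i (G.toProfile (Function.update a i b)) := by
  refine le_trans ?_ (hG.marginal_contribution _ i)
  have h1 : G.welfareWithout i (G.toProfile (Function.update a i b)) =
      G.f ((Finset.univ.erase i).image fun j => (⟨j, θ j, a j⟩ : G.Ground)) := by
    unfold welfareWithout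
    congr 1
    rw [Finset.filter_ne']
    refine Finset.image_congr fun j hj => ?_
    simp only [toProfile, Function.update_of_ne (Finset.ne_of_mem_erase hj)]
  have h2 : G.welfare (G.toProfile (Function.update a i b)) =
      G.f (insert ⟨i, θ i, b⟩
        ((Finset.univ.erase i).image fun j => (⟨j, θ j, a j⟩ : G.Ground))) := by
    unfold welfare
    congr 1
    rw [← Finset.insert_erase (Finset.mem_univ i), Finset.image_insert,
      Finset.erase_insert (Finset.notMem_erase i _)]
    congr 1
    · simp [toProfile]
    · refine Finset.image_congr fun j hj => ?_
      simp only [toProfile, Function.update_of_ne (Finset.ne_of_mem_erase hj)]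
  rw [h1, h2]
  exact hG.isMonoSubmodular.diminishing _ (Finset.image_subset_image (Finset.erase_subset _ _))

theorem IsValidUtility.welfare_sub_le_sum_utility {G : BayesianGame.{u, v} n}
    (hG : G.IsValidUtility) {θ : G.TypeProfile} (a b : G.ProfileAt θ) :
    G.welfare (G.toProfile b) - G.welfare (G.toProfile a) ≤
      ∑ i, G.utility i (G.toProfile (Function.update a i (b i))) := by
  classical
  have h := hG.welfare_le_add_sum b (G.chosen a)
  have h2 := Finset.sum_le_sum fun i (_ : i ∈ (Finset.univ : Finset (Fin n))) =>
    hG.marginal_le_utility a i (b i)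
  rw [welfare_toProfile G a]
  linarith

section Expectation

variable {G} (π : G.TypeDependentDist)

theorem expect_mono {g h : ∀ θ : G.TypeProfile, G.ProfileAt θ → ℝ} (hgh : ∀ θ a, g θ a ≤ h θ a) :
    G.expect π g ≤ G.expect π h :=
  Finset.sum_le_sum fun θ _ => mul_le_mul_of_nonneg_left
    (Finset.sum_le_sum fun a _ => mul_le_mul_of_nonneg_left (hgh θ a) ((π θ).2.1 a))
    (G.prior_mem.1 θ)

theorem expect_sub (g h : ∀ θ : G.TypeProfile, G.ProfileAt θ → ℝ) :
    G.expect π (fun θ a => g θ a - h θ a) = G.expect π g - G.expect π h := by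
  simp [expect, mul_sub]

theorem expect_sum {ι : Type*} (s : Finset ι)
    (g : ι → ∀ θ : G.TypeProfile, G.ProfileAt θ → ℝ) :
    G.expect π (fun θ a => ∑ i ∈ s, g i θ a) = ∑ i ∈ s, G.expect π (g i) := by
  simp only [expect, Finset.mul_sum]
  rw [Finset.sum_comm (s := s)]
  exact Finset.sum_congr rfl fun _ _ => Finset.sum_comm

theorem expect_const (g : G.TypeProfile → ℝ) :
    G.expect π (fun θ _ => g θ) = ∑ θ, G.prior θ * g θ := by
  simp [expect, ← Finset.sum_mul, (π _).2.2]

end Expectation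

/-- Every strategic-form coarse Bayesian solution has at least half of the welfare of the best
strategy profile. -/
theorem IsValidUtility.half_bestStrategyWelfare_le {G : BayesianGame.{u, v} n}
    (hG : G.IsValidUtility) {π : G.TypeDependentDist} (hπ : G.IsSFCBS π) :
    (1 / 2 : ℝ) * G.bestStrategyWelfare ≤ G.expWelfare π := by
  suffices h : G.bestStrategyWelfare ≤ 2 * G.expWelfare π by linarith
  refine ciSup_le fun s => ?_
  have h1 := expect_mono π fun θ a => hG.welfare_sub_le_sum_utility a (G.play s θ)
  rw [expect_sub, expect_const, expect_sum] at h1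
  have h2 := Finset.sum_le_sum fun i (_ : i ∈ (Finset.univ : Finset (Fin n))) => hπ i (s i)
  rw [← expect_sum π _ fun i _ a => G.utility i (G.toProfile a)] at h2
  have h3 : G.expect π (fun _ a => ∑ i, G.utility i (G.toProfile a)) ≤ G.expWelfare π :=
    expect_mono π fun θ a => hG.total_utility _
  simp only [play] at h1 ⊢
  unfold expWelfare at *
  linarith

/-! ### Randomized strategies -/

/-- The expected welfare if, at each type profile, every player `i` draws an action independently
with the weights that `q` assigns to her type. -/
noncomputable def mixedWelfare (q : ∀ i t, G.Act i t → ℝ) : ℝ :=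
  ∑ θ : G.TypeProfile, G.prior θ *
    ∑ a : G.ProfileAt θ, (∏ i, q i (θ i) (a i)) * G.welfare (G.toProfile a)

/-- Drawing an action for every type in advance turns `q` into a random strategy profile, and some
realization is at least as good as the average. -/
theorem mixedWelfare_le_bestStrategyWelfare {q : ∀ i t, G.Act i t → ℝ}
    (hq0 : ∀ i t a, 0 ≤ q i t a) (hq : ∀ i t, ∑ a, q i t a = 1) :
    G.mixedWelfare q ≤ G.bestStrategyWelfare := by
  classical
  set Q : ∀ i, G.Strategy i → ℝ := fun i s => ∏ t, q i t (s t) with hQ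
  have hQ1 : ∀ i, ∑ s, Q i s = 1 := fun i => sum_prod_eq_one (hq i)
  have hmarg : ∀ θ : G.TypeProfile,
      ∑ s : G.StrategyProfile, (∏ i, Q i (s i)) * G.welfare (G.toProfile (G.play s θ)) =
        ∑ a : G.ProfileAt θ, (∏ i, q i (θ i) (a i)) * G.welfare (G.toProfile a) := by
    intro θ
    refine sum_prod_mul_comp Q (fun i s => s (θ i)) (fun i => q i (θ i)) (fun i b => ?_)
      fun a : G.ProfileAt θ => G.welfare (G.toProfile a)
    have h := sum_prod_mul_eval (hq i) (θ i) fun a => if a = b then (1 : ℝ) else 0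
    simpa [hQ] using h
  have hle : ∀ s : G.StrategyProfile,
      ∑ θ, G.prior θ * G.welfare (G.toProfile (G.play s θ)) ≤ G.bestStrategyWelfare := fun s =>
    le_ciSup (f := fun s : G.StrategyProfile =>
      ∑ θ, G.prior θ * G.welfare (G.toProfile (G.play s θ))) (Set.finite_range _).bddAbove s
  calc G.mixedWelfare q
      = ∑ s : G.StrategyProfile, (∏ i, Q i (s i)) *
          ∑ θ, G.prior θ * G.welfare (G.toProfile (G.play s θ)) := by
        simp only [mixedWelfare, ← hmarg, Finset.mul_sum]
        rw [Finset.sum_comm]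
        exact Finset.sum_congr rfl fun _ _ => Finset.sum_congr rfl fun _ _ => by ring
    _ ≤ ∑ s : G.StrategyProfile, (∏ i, Q i (s i)) * G.bestStrategyWelfare :=
        Finset.sum_le_sum fun s _ => mul_le_mul_of_nonneg_left (hle s)
          (Finset.prod_nonneg fun i _ => Finset.prod_nonneg fun t _ => hq0 _ _ _)
    _ = G.bestStrategyWelfare := by rw [← Finset.sum_mul, sum_prod_eq_one hQ1, one_mul]

/-- An optimal feasible profile `b θ` at every type profile `θ`, and the conditional distributions
`q i` of the action of player `i` in `b θ` given her type. -/
theorem exists_optimal_conditional : ∃ (b : ∀ θ : G.TypeProfile, G.ProfileAt θ)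
    (q : ∀ i t, G.Act i t → ℝ),
    G.optWelfare = ∑ θ, G.prior θ * G.welfare (G.toProfile (b θ)) ∧
    (∀ i t a, 0 ≤ q i t a) ∧ (∀ i t, ∑ a, q i t a = 1) ∧
    ∀ (i : Fin n) (φ : ∀ t, G.Act i t → ℝ),
      ∑ θ : G.TypeProfile, G.prior θ * φ (θ i) (b θ i) =
        ∑ θ : G.TypeProfile, G.prior θ * ∑ a, q i (θ i) a * φ (θ i) a := by
  choose b hb using fun θ : G.TypeProfile =>
    exists_eq_ciSup_of_finite (f := fun a : G.ProfileAt θ => G.welfare (G.toProfile a))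
  choose q hq0 hq hqφ using fun i : Fin n =>
    exists_conditional G.prior_mem.1 (fun θ : G.TypeProfile => θ i) (fun θ => b θ i)
  exact ⟨b, q, Finset.sum_congr rfl fun θ _ => by rw [hb], hq0, hq, hqφ⟩

/-! ### Independent priors -/

/-- Under a product prior, the best strategy profile has at least `1 - 1 / e` of the optimal
welfare. -/
theorem IsValidUtility.optWelfare_le_of_independentPrior {G : BayesianGame.{u, v} n}
    (hG : G.IsValidUtility) (hind : G.IndependentPrior) :
    (1 - 1 / Real.exp 1) * G.optWelfare ≤ G.bestStrategyWelfare := by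
  classical
  obtain ⟨ρ, hρ, hprior⟩ := hind
  obtain ⟨b, q, hopt, hq0, hq, hqφ⟩ := G.exists_optimal_conditional
  refine le_trans ?_ (G.mixedWelfare_le_bestStrategyWelfare hq0 hq)
  -- The joint law of type and action of player `i`.
  set w : ∀ i, G.ActionOf i → ℝ := fun i x => ρ i x.1 * q i x.1 x.2 with hw
  have hρ1 : ∀ i, ∑ t, ρ i t = 1 := fun i => (hρ i).2
  have hw0 : ∀ i x, 0 ≤ w i x := fun i x => mul_nonneg ((hρ i).1 _) (hq0 _ _ _)
  have hw1 : ∀ i, ∑ x, w i x = 1 := fun i => by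
    simp [hw, Fintype.sum_sigma, ← Finset.mul_sum, hq, hρ1]
  have hwφ : ∀ i (φ : G.ActionOf i → ℝ),
      ∑ x, w i x * φ x = ∑ θ : G.TypeProfile, G.prior θ * φ ⟨θ i, b θ i⟩ := by
    intro i φ
    rw [hqφ i fun t a => φ ⟨t, a⟩]
    simp only [hprior]
    rw [sum_prod_mul_eval hρ1 i fun t => ∑ a, q i t a * φ ⟨t, a⟩]
    simp only [hw, Fintype.sum_sigma, Finset.mul_sum, mul_assoc]
  have hM : ∀ S, G.optWelfare ≤ G.f S + ∑ i, ∑ x : G.ActionOf i,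
      w i x * (G.f (insert ⟨i, x⟩ S) - G.f S) := by
    intro S
    have hS : G.f S = ∑ θ, G.prior θ * G.f S := by
      rw [← Finset.sum_mul, G.prior_mem.2, one_mul]
    simp only [hwφ _ fun x => G.f (insert ⟨_, x⟩ S) - G.f S]
    rw [Finset.sum_comm, hopt]
    nth_rw 1 [hS]
    rw [← Finset.sum_add_distrib]
    refine Finset.sum_le_sum fun θ _ => ?_
    rw [← Finset.mul_sum, ← mul_add]
    exact mul_le_mul_of_nonneg_left (hG.welfare_le_add_sum (b θ) S) (G.prior_mem.1 θ)
  refine (hG.isMonoSubmodular.correlation_gap G.f_nonneg hw0 hw1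
    (fun i x => (⟨i, x⟩ : G.Ground)) hM).trans_eq ?_
  let split : G.Profile ≃ Σ θ : G.TypeProfile, G.ProfileAt θ :=
    { toFun := fun x => ⟨fun i => (x i).1, fun i => (x i).2⟩
      invFun := fun y => G.toProfile y.2
      left_inv := fun _ => rfl
      right_inv := fun _ => rfl }
  rw [← split.symm.sum_comp, Fintype.sum_sigma]
  refine Finset.sum_congr rfl fun θ _ => ?_
  rw [Finset.mul_sum]
  refine Finset.sum_congr rfl fun a _ => ?_
  rw [hprior, ← mul_assoc, ← Finset.prod_mul_distrib]
  rfl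

/-! ### Correlated priors -/

/-- The main estimate for correlated priors, with a free sample size `k`. -/
theorem IsValidUtility.mul_optWelfare_le {G : BayesianGame.{u, v} n} (hG : G.IsValidUtility)
    (k : ℕ) : k * G.optWelfare ≤ (k ^ 2 + 2 * k + n) * G.bestStrategyWelfare := by
  classical
  obtain ⟨b, q, hopt, hq0, hq, hqφ⟩ := G.exists_optimal_conditional
  refine le_trans ?_ (mul_le_mul_of_nonneg_left (G.mixedWelfare_le_bestStrategyWelfare hq0 hq)
    (by positivity))
  have hf := hG.isMonoSubmodular
  set e : ∀ i t, G.Act i t → G.Ground := fun i t a => ⟨i, t, a⟩ with he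
  -- The law of the independently drawn profile at `θ`, its expected welfare, and the expected
  -- marginal values of fresh copies of the actions.
  set p : ∀ θ : G.TypeProfile, G.ProfileAt θ → ℝ := fun θ x => ∏ i, q i (θ i) (x i) with hp
  set V : G.TypeProfile → ℝ := fun θ => ∑ x, p θ x * G.f (G.chosen x) with hV
  set D : ∀ θ : G.TypeProfile, Fin n → G.ProfileAt θ → ℝ := fun θ i x =>
    ∑ a, q i (θ i) a * (G.f (insert (e i (θ i) a) (G.chosen x)) - G.f (G.chosen x)) with hD
  set H : ∀ i t, G.Act i t → ℝ := fun i t a =>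
    (insertAvg (q i t) (e i t))^[k] G.f {e i t a} - (insertAvg (q i t) (e i t))^[k] G.f ∅ with hH
  have hp0 : ∀ θ x, 0 ≤ p θ x := fun θ x => Finset.prod_nonneg fun i _ => hq0 _ _ _
  have hp1 : ∀ θ, ∑ x, p θ x = 1 := fun θ => sum_prod_eq_one fun i => hq i (θ i)
  have hDV : ∀ θ, ∑ x, p θ x * ∑ i, D θ i x ≤ V θ := fun θ =>
    hf.sum_resample_le (G.f_nonneg ∅) (fun i => hq0 i (θ i)) (fun i => hq i (θ i))
      (fun i => e i (θ i))
  have hB : G.mixedWelfare q = ∑ θ, G.prior θ * V θ := rfl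
  have h1 : ∀ θ, G.welfare (G.toProfile (b θ)) ≤ (1 + k) * V θ + ∑ i, H i (θ i) (b θ i) := by
    intro θ
    calc G.welfare (G.toProfile (b θ))
        = ∑ x, p θ x * G.welfare (G.toProfile (b θ)) := by
          rw [← Finset.sum_mul, hp1, one_mul]
      _ ≤ ∑ x, p θ x * (G.f (G.chosen x) + ∑ i, (k * D θ i x + H i (θ i) (b θ i))) := by
          refine Finset.sum_le_sum fun x _ => mul_le_mul_of_nonneg_left ?_ (hp0 θ x)
          refine (hG.welfare_le_add_sum (b θ) (G.chosen x)).trans ?_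
          gcongr with i
          exact hf.marginal_le (hq0 i (θ i)) (hq i (θ i)) k _ _
      _ = V θ + k * ∑ x, p θ x * ∑ i, D θ i x + ∑ i, H i (θ i) (b θ i) := by
          simp only [Finset.sum_add_distrib, mul_add, ← Finset.mul_sum, hV, ← Finset.sum_mul, hp1,
            one_mul, mul_left_comm _ (k : ℝ)]
          ring
      _ ≤ _ := by
          have := mul_le_mul_of_nonneg_left (hDV θ) (Nat.cast_nonneg (α := ℝ) k)
          linarith
  have h2 : ∀ θ : G.TypeProfile,
      k * ∑ i, ∑ a, q i (θ i) a * H i (θ i) a ≤ (n + k) * V θ := by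
    intro θ
    calc _ = ∑ x, p θ x * (k * ∑ i, ∑ a, q i (θ i) a * H i (θ i) a) := by
          rw [← Finset.sum_mul, hp1, one_mul]
      _ ≤ ∑ x, p θ x * ∑ i : Fin n, (G.f (G.chosen x) + k * D θ i x) := by
          refine Finset.sum_le_sum fun x _ => mul_le_mul_of_nonneg_left ?_ (hp0 θ x)
          rw [Finset.mul_sum]
          exact Finset.sum_le_sum fun i _ => hf.mul_sum_marginal_le (G.f_nonneg ∅) (hq0 i (θ i))
            (hq i (θ i)) k (G.chosen x)
      _ = n * V θ + k * ∑ x, p θ x * ∑ i, D θ i x := by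
          simp only [Finset.sum_add_distrib, mul_add, ← Finset.mul_sum, hV, Finset.sum_const,
            Finset.card_univ, Fintype.card_fin, nsmul_eq_mul, mul_left_comm _ (k : ℝ),
            mul_left_comm _ (n : ℝ)]
      _ ≤ _ := by
          have := mul_le_mul_of_nonneg_left (hDV θ) (Nat.cast_nonneg (α := ℝ) k)
          linarith
  have h3 : ∑ θ : G.TypeProfile, G.prior θ * ∑ i, H i (θ i) (b θ i) =
      ∑ θ : G.TypeProfile, G.prior θ * ∑ i, ∑ a, q i (θ i) a * H i (θ i) a := by
    simp only [Finset.mul_sum (Finset.univ : Finset (Fin n))]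
    rw [Finset.sum_comm, Finset.sum_congr rfl fun i _ => hqφ i (H i), Finset.sum_comm]
  have h4 : G.optWelfare ≤ (1 + k) * G.mixedWelfare q +
      ∑ θ : G.TypeProfile, G.prior θ * ∑ i, ∑ a, q i (θ i) a * H i (θ i) a := by
    rw [← h3, hopt, hB, Finset.mul_sum, ← Finset.sum_add_distrib]
    refine Finset.sum_le_sum fun θ _ => ?_
    have := mul_le_mul_of_nonneg_left (h1 θ) (G.prior_mem.1 θ)
    linarith
  have h5 : k * ∑ θ : G.TypeProfile, G.prior θ * ∑ i, ∑ a, q i (θ i) a * H i (θ i) a ≤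
      (n + k) * G.mixedWelfare q := by
    rw [hB, Finset.mul_sum, Finset.mul_sum]
    refine Finset.sum_le_sum fun θ _ => ?_
    have := mul_le_mul_of_nonneg_left (h2 θ) (G.prior_mem.1 θ)
    linarith
  have h6 := mul_le_mul_of_nonneg_left h4 (Nat.cast_nonneg (α := ℝ) k)
  linarith

/-- Under an arbitrary prior, the best strategy profile loses at most a factor of order `√n`
against the optimal welfare. -/
theorem IsValidUtility.optWelfare_le_sqrt_mul {G : BayesianGame.{u, v} n} (hn : 0 < n)
    (hG : G.IsValidUtility) :
    G.optWelfare ≤ 8 * Real.sqrt n * G.bestStrategyWelfare := by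
  have h := hG.mul_optWelfare_le (n.sqrt + 1)
  set k : ℝ := ((n.sqrt + 1 : ℕ) : ℝ) with hk
  have hk1 : 1 ≤ k := by simp [hk]
  have hnk : (n : ℝ) ≤ k ^ 2 := by
    rw [hk]; exact_mod_cast (Nat.lt_succ_sqrt' n).le
  have hs1 : 1 ≤ Real.sqrt n := Real.one_le_sqrt.2 (by exact_mod_cast hn)
  have hks : k ≤ 2 * Real.sqrt n := by
    have := Real.nat_sqrt_le_real_sqrt (a := n)
    rw [hk]; push_cast; linarith
  have hB : 0 ≤ G.bestStrategyWelfare :=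
    Real.iSup_nonneg fun s => Finset.sum_nonneg fun θ _ =>
      mul_nonneg (G.prior_mem.1 θ) (G.f_nonneg _)
  have h1 : k * G.optWelfare ≤ k * (8 * Real.sqrt n * G.bestStrategyWelfare) := by
    refine h.trans ?_
    rw [← mul_assoc]
    refine mul_le_mul_of_nonneg_right ?_ hB
    have h2 := mul_le_mul_of_nonneg_left hks (zero_le_one.trans hk1)
    nlinarith
  exact le_of_mul_le_mul_left h1 (by linarith)

/-! ### The price of anarchy -/

theorem ofReal_le_priceOfAnarchy {P : Set G.TypeDependentDist} (hopt : 0 < G.optWelfare) {c : ℝ}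
    (h : ∀ π ∈ P, c * G.optWelfare ≤ G.expWelfare π) :
    ENNReal.ofReal c ≤ G.priceOfAnarchy P := by
  unfold priceOfAnarchy
  rw [ENNReal.le_div_iff_mul_le (Or.inl (ENNReal.ofReal_pos.2 hopt).ne')
    (Or.inl ENNReal.ofReal_ne_top), ← ENNReal.ofReal_mul' hopt.le]
  exact le_iInf₂ fun π hπ => ENNReal.ofReal_le_ofReal (h π hπ)

end BayesianGame

theorem mainTheorem5 :
    (∀ (n : ℕ) (G : BayesianGame.{u, v} n), G.IsValidUtility →
      ∀ π : G.TypeDependentDist, G.IsSFCBS π →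
        (1 / 2 : ℝ) * G.bestStrategyWelfare ≤ G.expWelfare π) ∧
    (∀ (n : ℕ) (G : BayesianGame.{u, v} n), G.IsValidUtility → G.IndependentPrior →
      0 < G.optWelfare →
        ENNReal.ofReal ((1 - 1 / Real.exp 1) / 2) ≤ G.priceOfAnarchy {π | G.IsSFCBS π}) ∧
    (∃ c : ℝ, 0 < c ∧
      ∀ (n : ℕ) (G : BayesianGame.{u, v} n), 0 < n → G.IsValidUtility →
        0 < G.optWelfare →
          ENNReal.ofReal (c / Real.sqrt n) ≤ G.priceOfAnarchy {π | G.IsSFCBS π}) := by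
  refine ⟨fun n G hG π hπ => hG.half_bestStrategyWelfare_le hπ, fun n G hG hind hopt => ?_,
    1 / 16, by norm_num, fun n G hn hG hopt => ?_⟩
  · refine G.ofReal_le_priceOfAnarchy hopt fun π hπ => ?_
    have h1 := hG.half_bestStrategyWelfare_le hπ
    have h2 := hG.optWelfare_le_of_independentPrior hind
    linarith
  · refine G.ofReal_le_priceOfAnarchy hopt fun π hπ => ?_
    have h1 := hG.half_bestStrategyWelfare_le hπ
    have h2 := hG.optWelfare_le_sqrt_mul hn
    have hs : 0 < Real.sqrt n := Real.sqrt_pos.2 (by exact_mod_cast hn)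
    rw [div_mul_eq_mul_div, div_le_iff₀ hs]
    have h3 := mul_le_mul_of_nonneg_right h1 hs.le
    linarith
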